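/- Call a subset $U\subseteq[0,1]$ *fine-open* if for every irrational $x\in U$ and every $\varepsilon>0$ there is $\delta>0$ such that for every closed interval $[r,s]\subseteq[0,1]$ with rational endpoints that contains $x$ and has length less than $\delta$, there is a finite family of pairwise disjoint closed intervals with rational endpoints, each contained in $U\cap[r,s]$, of total length at least $(1-\varepsilon)(s-r)$. The fine-open sets form a topology on $[0,1]$, the *fine topology*. Let $G$ be the additive group of all functions $[0,1]\to\mathbb Z$ that are continuous from the fine topology to the discrete topology of $\mathbb Z$, and for $x\in[0,1]$ let $h_x:G\to\mathbb Z$, $h_x(g)=g(x)$. Then: 1. The group $\mathrm{Hom}(G,\mathbb Z)$ is free abelian with basis $(h_x)_{x\in[0,1]}$. 2. Let $G_0\subseteq\mathbb Z^{[0,1]\cap\mathbb Q}$ be the group of the restrictions to $[0,1]\cap\mathbb Q$ of the members of $G$. The restriction map $\rho:G\to G_0$ is an isomorphism of groups, and $\varphi\mapsto\varphi\circ\rho$ is an isomorphism $\mathrm{Hom}(G_0,\mathbb Z)\to\mathrm{Hom}(G,\mathbb Z)$. 3. The group $\mathbb Z^\omega$ has a subgroup $H$, isomorphic to $G_0$,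 such that $\mathrm{Hom}(H,\mathbb Z)$ is free abelian of rank $2^{\aleph_0}$. -/

import Mathlib

open MeasureTheory

/-- `F` is (the set of endpoint pairs of) a finite family of pairwise disjoint closed intervals
with rational endpoints, all of them contained in `A`. -/
def IsRatIntervalFamily (F : Finset (ℚ × ℚ)) (A : Set ℝ) : Prop :=
  (∀ p ∈ F, p.1 ≤ p.2 ∧ Set.Icc (p.1 : ℝ) (p.2 : ℝ) ⊆ A) ∧
    (F : Set (ℚ × ℚ)).PairwiseDisjoint fun p => Set.Icc (p.1 : ℝ) (p.2 : ℝ)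

/-- The sum of the lengths of the intervals in the family `F`. -/
def totalLength (F : Finset (ℚ × ℚ)) : ℚ :=
  ∑ p ∈ F, (p.2 - p.1)

/-- Openness in the fine topology on `[0,1]`. -/
def IsFineOpen (U : Set unitInterval) : Prop :=
  ∀ x ∈ U, Irrational (x : ℝ) → ∀ ε : ℝ, 0 < ε → ∃ δ : ℝ, 0 < δ ∧
    ∀ r s : ℚ, 0 ≤ r → s ≤ 1 → (r : ℝ) ≤ (x : ℝ) → (x : ℝ) ≤ (s : ℝ) → ((s - r : ℚ) : ℝ) < δ →
      ∃ F : Finset (ℚ × ℚ),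
        IsRatIntervalFamily F (Subtype.val '' U ∩ Set.Icc (r : ℝ) (s : ℝ)) ∧
          (1 - ε) * ((s - r : ℚ) : ℝ) ≤ ((totalLength F : ℚ) : ℝ)

theorem IsRatIntervalFamily.volume_eq {F : Finset (ℚ × ℚ)} {A : Set ℝ}
    (h : IsRatIntervalFamily F A) :
    volume.real (⋃ p ∈ F, Set.Icc (p.1 : ℝ) (p.2 : ℝ)) = ((totalLength F : ℚ) : ℝ) := by
  rw [measureReal_biUnion_finset h.2 (fun p _ => measurableSet_Icc) (fun p _ => by simp)]
  rw [totalLength]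
  push_cast
  refine Finset.sum_congr rfl fun p hp => ?_
  have : (p.1 : ℝ) ≤ p.2 := by exact_mod_cast (h.1 p hp).1
  rw [Real.volume_real_Icc_of_le this]

theorem IsRatIntervalFamily.inter {F F' : Finset (ℚ × ℚ)} {A A' : Set ℝ} {r s : ℝ}
    (hrs : r ≤ s) (hF : IsRatIntervalFamily F (A ∩ Set.Icc r s))
    (hF' : IsRatIntervalFamily F' (A' ∩ Set.Icc r s)) :
    ∃ N : Finset (ℚ × ℚ), IsRatIntervalFamily N ((A ∩ A') ∩ Set.Icc r s) ∧
      ((totalLength F : ℚ) : ℝ) + ((totalLength F' : ℚ) : ℝ) - (s - r) ≤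
        ((totalLength N : ℚ) : ℝ) := by
  classical
  let m : (ℚ × ℚ) × (ℚ × ℚ) → ℚ × ℚ := fun z => (max z.1.1 z.2.1, min z.1.2 z.2.2)
  have hm : ∀ z, Set.Icc ((m z).1 : ℝ) ((m z).2 : ℝ) =
      Set.Icc (z.1.1 : ℝ) (z.1.2 : ℝ) ∩ Set.Icc (z.2.1 : ℝ) (z.2.2 : ℝ) := by
    intro z
    rw [Set.Icc_inter_Icc]
    simp [m]
  let N : Finset (ℚ × ℚ) := ((F ×ˢ F').image m).filter fun p => p.1 ≤ p.2
  have hN : IsRatIntervalFamily N ((A ∩ A') ∩ Set.Icc r s) := by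
    refine ⟨fun p hp => ?_, fun p hp q hq hpq => ?_⟩
    · obtain ⟨hp1, hp2⟩ := Finset.mem_filter.1 hp
      obtain ⟨z, hz, rfl⟩ := Finset.mem_image.1 hp1
      obtain ⟨hz1, hz2⟩ := Finset.mem_product.1 hz
      refine ⟨hp2, ?_⟩
      rw [hm]
      rintro t ⟨ht1, ht2⟩
      have h1 := (hF.1 _ hz1).2 ht1
      have h2 := (hF'.1 _ hz2).2 ht2
      exact ⟨⟨h1.1, h2.1⟩, h1.2⟩
    · obtain ⟨z, hz, rfl⟩ := Finset.mem_image.1 (Finset.mem_filter.1 (Finset.mem_coe.1 hp)).1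
      obtain ⟨w, hw, rfl⟩ := Finset.mem_image.1 (Finset.mem_filter.1 (Finset.mem_coe.1 hq)).1
      obtain ⟨hz1, hz2⟩ := Finset.mem_product.1 hz
      obtain ⟨hw1, hw2⟩ := Finset.mem_product.1 hw
      change Disjoint (Set.Icc ((m z).1 : ℝ) ((m z).2 : ℝ)) (Set.Icc ((m w).1 : ℝ) ((m w).2 : ℝ))
      rw [hm, hm]
      by_cases h1 : z.1 = w.1
      · have h2 : z.2 ≠ w.2 := fun h2 => hpq (congrArg m (Prod.ext h1 h2))
        exact (hF'.2 hz2 hw2 h2).mono Set.inter_subset_right Set.inter_subset_right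
      · exact (hF.2 hz1 hw1 h1).mono Set.inter_subset_left Set.inter_subset_left
  refine ⟨N, hN, ?_⟩
  rw [← hF.volume_eq, ← hF'.volume_eq, ← hN.volume_eq]
  set B : Set ℝ := ⋃ p ∈ F, Set.Icc (p.1 : ℝ) (p.2 : ℝ) with hB
  set B' : Set ℝ := ⋃ p ∈ F', Set.Icc (p.1 : ℝ) (p.2 : ℝ) with hB'
  have hBs : B ⊆ Set.Icc r s :=
    Set.iUnion₂_subset fun p hp => ((hF.1 p hp).2.trans Set.inter_subset_right)
  have hBs' : B' ⊆ Set.Icc r s :=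
    Set.iUnion₂_subset fun p hp => ((hF'.1 p hp).2.trans Set.inter_subset_right)
  have hIcc : volume (Set.Icc r s) ≠ ⊤ := by simp
  have hBm : MeasurableSet B' := Finset.measurableSet_biUnion _ fun p _ => measurableSet_Icc
  have hinter : B ∩ B' ⊆ ⋃ p ∈ N, Set.Icc (p.1 : ℝ) (p.2 : ℝ) := by
    rintro t ⟨ht, ht'⟩
    obtain ⟨p, hp, htp⟩ := Set.mem_iUnion₂.1 ht
    obtain ⟨q, hq, htq⟩ := Set.mem_iUnion₂.1 ht'
    have htm : t ∈ Set.Icc ((m (p, q)).1 : ℝ) ((m (p, q)).2 : ℝ) := by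
      rw [hm]; exact ⟨htp, htq⟩
    refine Set.mem_iUnion₂.2 ⟨m (p, q), Finset.mem_filter.2
      ⟨Finset.mem_image_of_mem m (Finset.mem_product.2 ⟨hp, hq⟩), ?_⟩, htm⟩
    exact_mod_cast htm.1.trans htm.2
  have hNfin : volume (⋃ p ∈ N, Set.Icc (p.1 : ℝ) (p.2 : ℝ)) ≠ ⊤ :=
    measure_ne_top_of_subset
      (Set.iUnion₂_subset fun p hp => ((hN.1 p hp).2.trans Set.inter_subset_right)) hIcc
  have h1 : volume.real (B ∩ B') ≤ volume.real (⋃ p ∈ N, Set.Icc (p.1 : ℝ) (p.2 : ℝ)) :=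
    measureReal_mono hinter hNfin
  have h2 : volume.real (B ∪ B') ≤ s - r := by
    rw [← Real.volume_real_Icc_of_le hrs]
    exact measureReal_mono (Set.union_subset hBs hBs') hIcc
  have h3 := measureReal_union_add_inter (μ := volume) (s := B) (t := B') hBm
    (measure_ne_top_of_subset hBs hIcc) (measure_ne_top_of_subset hBs' hIcc)
  linarith

/-- The fine ("perforated neighborhood") topology on `[0,1]`. -/
@[reducible] def fineTopology : TopologicalSpace unitInterval where
  IsOpen := IsFineOpen
  isOpen_univ := by
    intro x _ _ ε hε
    refine ⟨1, one_pos, fun r s hr hs hrx hxs _ => ?_⟩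
    have hrs : r ≤ s := by exact_mod_cast hrx.trans hxs
    refine ⟨{(r, s)}, ⟨?_, ?_⟩, ?_⟩
    · intro p hp
      obtain rfl := Finset.mem_singleton.1 hp
      refine ⟨hrs, fun t ht => ⟨⟨⟨t, ?_, ?_⟩, trivial, rfl⟩, ht⟩⟩
      · exact le_trans (by exact_mod_cast hr) ht.1
      · exact le_trans ht.2 (by exact_mod_cast hs)
    · simp
    · have : (0 : ℝ) ≤ ((s - r : ℚ) : ℝ) := by exact_mod_cast sub_nonneg.2 hrs
      simp only [totalLength, Finset.sum_singleton]
      nlinarith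
  isOpen_inter := by
    intro U V hU hV x hx hirr ε hε
    obtain ⟨δ, hδ, h⟩ := hU x hx.1 hirr (ε / 2) (half_pos hε)
    obtain ⟨δ', hδ', h'⟩ := hV x hx.2 hirr (ε / 2) (half_pos hε)
    refine ⟨min δ δ', lt_min hδ hδ', fun r s hr hs hrx hxs hlt => ?_⟩
    obtain ⟨F, hF, hFl⟩ := h r s hr hs hrx hxs (hlt.trans_le (min_le_left _ _))
    obtain ⟨F', hF', hFl'⟩ := h' r s hr hs hrx hxs (hlt.trans_le (min_le_right _ _))
    obtain ⟨N, hN, hNl⟩ := hF.inter (hrx.trans hxs) hF'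
    rw [← Set.image_inter Subtype.val_injective] at hN
    refine ⟨N, hN, le_trans ?_ hNl⟩
    push_cast at hFl hFl' ⊢
    linarith
  isOpen_sUnion := by
    intro S hS x hx hirr ε hε
    obtain ⟨U, hU, hxU⟩ := hx
    obtain ⟨δ, hδ, h⟩ := hS U hU x hxU hirr ε hε
    refine ⟨δ, hδ, fun r s hr hs hrx hxs hlt => ?_⟩
    obtain ⟨F, hF, hFl⟩ := h r s hr hs hrx hxs hlt
    refine ⟨F, ⟨fun p hp => ⟨(hF.1 p hp).1, (hF.1 p hp).2.trans ?_⟩, hF.2⟩, hFl⟩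
    exact Set.inter_subset_inter_left _ (Set.image_mono (Set.subset_sUnion_of_mem hU))

/-- The group `G` of all functions `[0,1] → ℤ` that are continuous from the fine topology to the
(discrete) topology of `ℤ`. -/
def fineG : AddSubgroup (unitInterval → ℤ) where
  carrier := {g | @Continuous unitInterval ℤ fineTopology inferInstance g}
  zero_mem' := @continuous_const unitInterval ℤ fineTopology _ 0
  add_mem' := fun ha hb => by
    let _ := fineTopology
    exact Continuous.add ha hb
  neg_mem' := fun ha => by
    let _ := fineTopology
    exact Continuous.neg ha

/-- The evaluation homomorphism `h_x : G → ℤ`. -/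
def evalHom (x : unitInterval) : fineG →+ ℤ :=
  (Pi.evalAddMonoidHom (fun _ : unitInterval => ℤ) x).comp fineG.subtype

/-- The set `[0,1] ∩ ℚ`, as a type. -/
abbrev RatPoint : Type := {x : unitInterval // ∃ q : ℚ, (q : ℝ) = (x : ℝ)}

/-- Restriction of functions from `[0,1]` to `[0,1] ∩ ℚ`. -/
def restrictRat : (unitInterval → ℤ) →+ (RatPoint → ℤ) where
  toFun g := fun y => g y.1
  map_zero' := rfl
  map_add' _ _ := rfl

/-- The group `G₀` of the restrictions to `[0,1] ∩ ℚ` of the members of `G`. -/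
def fineG₀ : AddSubgroup (RatPoint → ℤ) :=
  fineG.map restrictRat

/-- The restriction homomorphism `G → G₀`. -/
def restrictHom : fineG →+ fineG₀ :=
  restrictRat.addSubgroupMap fineG

/-! Everything rests on Specker's two facts about homomorphisms ℤ^ℕ → ℤ: they kill almost all unit
vectors, and they are zero if they kill all of them. A fine-locally constant map to ℕ cuts [0,1]
into clopen fibres, and gluing along them (`glueHom`) gives homomorphisms ℤ^ℕ → G. Pulling φ : G → ℤ
back along these shows that almost all fibres are null for φ, and that a clopen set covered by
countably many clopen null sets is null.

Let the support of φ consist of the points in no null rational interval. If it were infinite, it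
would accumulate at some x. Tiny rational intervals around support points converging fast to x leave
a complement of density 1 at x, so numbering them is fine-locally constant and almost all of them
are null, which is absurd. Hence the support is finite (`fineSupport_finite`). If g vanishes there,
countably many null intervals cover {g ≠ 0}, so φ g = 0. As rational intervals are clopen and
separate points, φ is a unique combination of evaluations.

Finally, a fine-open set with an irrational point also contains rational points, so restriction to
the countable set of rationals loses nothing and places G inside ℤ^ℕ. -/

/-! ### Homomorphisms from ℤ^ℕ to ℤ -/

/-- A homomorphism `ℤ^ℕ → ℤ` vanishes on almost all unit vectors. -/
theorem exists_forall_map_single_eq_zero (ψ : (ℕ → ℤ) →+ ℤ) :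
    ∃ N, ∀ n ≥ N, ψ (Pi.single n 1) = 0 := by
  let b : ℕ → ℤ := fun n => ψ (Pi.single n 1)
  -- `D n = (d, S)` with `S` the partial sum of the first `n` terms `d i * b i`
  let D : ℕ → ℤ × ℤ := fun n => Nat.rec (1, 0)
    (fun n p => (p.1 * (|p.2 + p.1 * b n| + n + 2), p.2 + p.1 * b n)) n
  let d : ℕ → ℤ := fun n => (D n).1
  let S : ℕ → ℤ := fun n => (D n).2
  have hS : ∀ n, S (n + 1) = S n + d n * b n := fun n => rfl
  -- The new factor makes `d (n + 1)` exceed `|ψ d| + |S (n + 1)|` once `n ≥ |ψ d|`; divisibility of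
  -- `ψ d - S (n + 1)` by `d (n + 1)` then forces equality.
  have hd : ∀ n, d (n + 1) = d n * (|S (n + 1)| + n + 2) := fun n => rfl
  have hpos : ∀ n, 1 ≤ d n := by
    intro n
    induction n with
    | zero => exact le_refl _
    | succ k ih =>
      rw [hd]
      have := abs_nonneg (S (k + 1))
      nlinarith
  have hdvd : ∀ n k, d n ∣ d (n + k) := by
    intro n k
    induction k with
    | zero => exact dvd_rfl
    | succ k ih => exact ih.trans ⟨_, hd (n + k)⟩
  have key : ∀ n, d n ∣ ψ d - S n := by
    intro n
    have h1 : ∀ m, ψ (fun i => if i < m then d i else 0) = S m := by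
      intro m
      induction m with
      | zero =>
        have : (fun i => if i < 0 then d i else 0) = (0 : ℕ → ℤ) := by ext i; simp
        rw [this, map_zero]; rfl
      | succ m ih =>
        have : (fun i => if i < m + 1 then d i else 0) =
            (fun i => if i < m then d i else 0) + d m • (Pi.single m 1 : ℕ → ℤ) := by
          ext i
          rcases lt_trichotomy i m with h | rfl | h
          · simp [h, h.ne, h.trans (Nat.lt_succ_self m)]
          · simp
          · simp [h.ne', not_lt.2 h.le, not_lt.2 (Nat.succ_le_of_lt h)]
        rw [this, map_add, ih, map_zsmul, hS, smul_eq_mul]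
    have h2 : ∀ i, ∃ q, (if i < n then 0 else d i) = d n * q := by
      intro i
      split_ifs with h
      · exact ⟨0, by simp⟩
      · obtain ⟨k, rfl⟩ := Nat.exists_eq_add_of_le (not_lt.1 h)
        exact hdvd n k
    choose q hq using h2
    have h3 : d = (fun i => if i < n then d i else 0) + d n • q := by
      ext i
      have := hq i
      simp only [Pi.add_apply, Pi.smul_apply, smul_eq_mul, ← this]
      split_ifs <;> simp
    refine ⟨ψ q, ?_⟩
    conv_lhs => rw [h3]
    rw [map_add, h1, map_zsmul, smul_eq_mul]
    ring
  have heq : ∀ n : ℕ, |ψ d| ≤ n → ψ d = S (n + 1) := by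
    intro n hn
    refine sub_eq_zero.1 (Int.eq_zero_of_abs_lt_dvd (key (n + 1)) ?_)
    have h1 := abs_sub (ψ d) (S (n + 1))
    have h2 := hpos n
    have h3 := abs_nonneg (S (n + 1))
    rw [hd]
    nlinarith
  refine ⟨(ψ d).natAbs + 1, fun n hn => ?_⟩
  obtain ⟨m, rfl⟩ : ∃ m, n = m + 1 := ⟨n - 1, by omega⟩
  have habs := Int.abs_eq_natAbs (ψ d)
  have h1 := heq m (by omega)
  have h2 := heq (m + 1) (by omega)
  have h3 := hS (m + 1)
  have h4 : d (m + 1) * b (m + 1) = 0 := by linarith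
  exact (mul_eq_zero.1 h4).resolve_left (by have := hpos (m + 1); omega)

/-- A homomorphism `ℤ^ℕ → ℤ` that vanishes on the unit vectors is zero. -/
theorem map_eq_zero_of_forall_single (ψ : (ℕ → ℤ) →+ ℤ) (h : ∀ n, ψ (Pi.single n 1) = 0)
    (a : ℕ → ℤ) : ψ a = 0 := by
  have hfin : ∀ (c : ℕ → ℤ) (n : ℕ), ψ (fun i => if i < n then c i else 0) = 0 := by
    intro c n
    induction n with
    | zero =>
      have : (fun i => if i < 0 then c i else 0) = (0 : ℕ → ℤ) := by ext i; simp
      rw [this, map_zero]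
    | succ m ih =>
      have : (fun i => if i < m + 1 then c i else 0) =
          (fun i => if i < m then c i else 0) + c m • (Pi.single m 1 : ℕ → ℤ) := by
        ext i
        rcases lt_trichotomy i m with h | rfl | h
        · simp [h, h.ne, h.trans (Nat.lt_succ_self m)]
        · simp
        · simp [h.ne', not_lt.2 h.le, not_lt.2 (Nat.succ_le_of_lt h)]
      rw [this, map_add, ih, map_zsmul, h, smul_zero, add_zero]
  -- Modulo `p ^ n` only the first `n` coordinates count, and `hfin` kills those; so the value is
  -- divisible by every power of `p`.
  have hpow : ∀ (p : ℤ), 2 ≤ p → ∀ u : ℕ → ℤ, ψ (fun i => p ^ i * u i) = 0 := by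
    intro p hp u
    have hdvd : ∀ n, p ^ n ∣ ψ (fun i => p ^ i * u i) := by
      intro n
      have : (fun i => p ^ i * u i) = (fun i => if i < n then p ^ i * u i else 0) +
          p ^ n • (fun i => if i < n then 0 else p ^ (i - n) * u i) := by
        ext i
        simp only [Pi.add_apply, Pi.smul_apply, smul_eq_mul]
        split_ifs with hi
        · simp
        · rw [← mul_assoc, ← pow_add, Nat.add_sub_cancel' (not_lt.1 hi), zero_add]
      rw [this, map_add, hfin, zero_add, map_zsmul, smul_eq_mul]
      exact dvd_mul_right _ _
    refine Int.eq_zero_of_abs_lt_dvd (hdvd (ψ (fun i => p ^ i * u i)).natAbs) ?_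
    rw [Int.abs_eq_natAbs]
    calc (((ψ (fun i => p ^ i * u i)).natAbs : ℕ) : ℤ)
        < ((2 ^ (ψ (fun i => p ^ i * u i)).natAbs : ℕ) : ℤ) := by
          exact_mod_cast Nat.lt_two_pow_self
      _ ≤ p ^ (ψ (fun i => p ^ i * u i)).natAbs := by
          push_cast
          gcongr
  have hcop : ∀ i : ℕ, ∃ u v : ℤ, a i = 2 ^ i * u + 3 ^ i * v := by
    intro i
    have : IsCoprime ((2 : ℤ) ^ i) (3 ^ i) := IsCoprime.pow ⟨-1, 1, by norm_num⟩
    obtain ⟨u, v, huv⟩ := this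
    exact ⟨u * a i, v * a i, by linear_combination (-a i) * huv⟩
  choose u v huv using hcop
  have : a = (fun i => 2 ^ i * u i) + (fun i => 3 ^ i * v i) := by
    ext i
    exact huv i
  rw [this, map_add, hpow 2 le_rfl, hpow 3 (by norm_num), add_zero]

/-! ### Null sets for homomorphisms on locally constant functions -/

section LocallyConstant

variable {X : Type*} {G : AddSubgroup (X → ℤ)}

/-- The subset `A` is null for `φ` if `φ` annihilates the functions supported in `A`. -/
def IsNullFor (φ : G →+ ℤ) (A : Set X) : Prop :=
  ∀ g : G, (∀ y ∉ A, g.1 y = 0) → φ g = 0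

theorem IsNullFor.mono {φ : G →+ ℤ} {A B : Set X} (hB : IsNullFor φ B) (h : A ⊆ B) :
    IsNullFor φ A :=
  fun g hg => hB g fun y hy => hg y fun hA => hy (h hA)

variable [TopologicalSpace X]

theorem isLocallyConstant_glue {ν : X → ℕ} (hν : IsLocallyConstant ν) {g : ℕ → X → ℤ}
    (hg : ∀ n, IsLocallyConstant (g n)) : IsLocallyConstant fun x => g (ν x) x := by
  rw [IsLocallyConstant.iff_eventually_eq]
  intro x
  filter_upwards [(IsLocallyConstant.iff_eventually_eq _).1 hν x,
    (IsLocallyConstant.iff_eventually_eq _).1 (hg (ν x)) x] with y h1 h2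
  rw [h1, h2]

/-- Glue multiples of the functions `g n` along the fibres of `ν`. -/
def glueHom (hG : ∀ f : X → ℤ, f ∈ G ↔ IsLocallyConstant f) {ν : X → ℕ}
    (hν : IsLocallyConstant ν) (g : ℕ → G) : (ℕ → ℤ) →+ G where
  toFun a := ⟨fun x => a (ν x) * (g (ν x)).1 x, (hG _).2 <|
    isLocallyConstant_glue (g := fun n x => a n * (g n).1 x) hν
      fun n => ((hG _).1 (g n).2).comp (a n * ·)⟩
  map_zero' := by ext x; simp
  map_add' a b := by ext x; simp [add_mul]

theorem glueHom_apply (hG : ∀ f : X → ℤ, f ∈ G ↔ IsLocallyConstant f) {ν : X → ℕ}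
    (hν : IsLocallyConstant ν) (g : ℕ → G) (a : ℕ → ℤ) (x : X) :
    (glueHom hG hν g a).1 x = a (ν x) * (g (ν x)).1 x := rfl

/-- Almost all fibres of a locally constant function `X → ℕ` are null. -/
theorem exists_forall_isNullFor_fiber (hG : ∀ f : X → ℤ, f ∈ G ↔ IsLocallyConstant f)
    (φ : G →+ ℤ) {ν : X → ℕ} (hν : IsLocallyConstant ν) :
    ∃ N, ∀ n ≥ N, IsNullFor φ (ν ⁻¹' {n}) := by
  -- `g n` witnesses that the fibre is not null, if it is not; `glueHom` sends the `n`-th unit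
  -- vector to it.
  have hch : ∀ n, ∃ g : G, (∀ y ∉ ν ⁻¹' {n}, g.1 y = 0) ∧
      (φ g = 0 → IsNullFor φ (ν ⁻¹' {n})) := by
    intro n
    by_cases h : IsNullFor φ (ν ⁻¹' {n})
    · exact ⟨0, fun _ _ => rfl, fun _ => h⟩
    · obtain ⟨g, hg, hne⟩ : ∃ g : G, (∀ y ∉ ν ⁻¹' {n}, g.1 y = 0) ∧ φ g ≠ 0 := by
        simpa [IsNullFor] using h
      exact ⟨g, hg, fun h0 => absurd h0 hne⟩
  choose g hg hφ using hch
  obtain ⟨N, hN⟩ := exists_forall_map_single_eq_zero (φ.comp (glueHom hG hν g))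
  refine ⟨N, fun n hn => hφ n ?_⟩
  rw [← hN n hn, AddMonoidHom.comp_apply]
  congr 1
  ext x
  rw [glueHom_apply]
  by_cases hx : ν x = n
  · subst hx
    simp
  · rw [Pi.single_eq_of_ne hx, zero_mul, hg n x hx]

/-- A clopen set covered by countably many clopen null sets is null. -/
theorem IsNullFor.of_subset_iUnion (hG : ∀ f : X → ℤ, f ∈ G ↔ IsLocallyConstant f)
    {φ : G →+ ℤ} {C : Set X} (hC : IsClopen C) {I : ℕ → Set X} (hI : ∀ n, IsClopen (I n))
    (hnull : ∀ n, IsNullFor φ (I n)) (hCI : C ⊆ ⋃ n, I n) : IsNullFor φ C := by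
  classical
  -- Disjointify the cover: 0 off `C`, otherwise one plus the first index of a set containing the
  -- point.
  let ν : X → ℕ := fun x => if h : ∃ n, x ∈ C ∩ I n then Nat.find h + 1 else 0
  have hν0 : ∀ x, ν x = 0 ↔ x ∉ C := by
    intro x
    by_cases h : ∃ n, x ∈ C ∩ I n
    · simp only [ν, dif_pos h, Nat.succ_ne_zero, false_iff, not_not]
      exact h.choose_spec.1
    · have : x ∉ C := fun hx => h (by simpa [hx] using hCI hx)
      simp [ν, this]
  have hν1 : ∀ x n, ν x = n + 1 ↔ x ∈ C ∩ (I n \ ⋃ m ∈ Set.Iio n, I m) := by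
    intro x n
    by_cases h : ∃ n, x ∈ C ∩ I n
    · have hx := h.choose_spec.1
      simp only [ν, dif_pos h, Nat.succ_inj, Nat.find_eq_iff]
      simp [hx]
    · have : x ∉ C := fun hx => h (by simpa [hx] using hCI hx)
      simp [ν, this]
  have hν : IsLocallyConstant ν := by
    refine (IsLocallyConstant.iff_continuous ν).2 (continuous_discrete_rng.2 fun n => ?_)
    rcases n with _ | n
    · have : ν ⁻¹' {0} = Cᶜ := by ext x; exact hν0 x
      rw [this]
      exact hC.compl.isOpen
    · have : ν ⁻¹' {n + 1} = C ∩ (I n \ ⋃ m ∈ Set.Iio n, I m) := by ext x; exact hν1 x n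
      rw [this]
      exact (hC.inter ((hI n).diff ((Set.finite_Iio n).isClopen_biUnion fun m _ => hI m))).isOpen
  intro g hg
  -- The constant sequence 1 glues back to `g`, while each unit vector gives a piece of `g` inside
  -- one null set, or zero for the label 0.
  have h1 : g = glueHom hG hν (fun _ => g) 1 := by
    ext x
    simp [glueHom_apply]
  rw [h1]
  refine map_eq_zero_of_forall_single (φ.comp (glueHom hG hν fun _ => g)) (fun n => ?_) 1
  rcases n with _ | n
  · have : glueHom hG hν (fun _ => g) (Pi.single 0 1) = 0 := by
      ext x
      rw [glueHom_apply]
      by_cases hx : ν x = 0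
      · rw [hg x ((hν0 x).1 hx)]
        simp
      · simp [hx]
    rw [AddMonoidHom.comp_apply, this, map_zero]
  · refine hnull n _ fun x hx => ?_
    rw [glueHom_apply]
    have : ν x ≠ n + 1 := fun h => hx ((hν1 x n).1 h).2.1
    simp [this]

end LocallyConstant

/-! ### Density estimates and clopen intervals -/

/-- The density condition at `x` in the definition of the fine topology. -/
def HasFineDensity (U : Set unitInterval) (x : unitInterval) : Prop :=
  ∀ ε : ℝ, 0 < ε → ∃ δ : ℝ, 0 < δ ∧
    ∀ r s : ℚ, 0 ≤ r → s ≤ 1 → (r : ℝ) ≤ (x : ℝ) → (x : ℝ) ≤ (s : ℝ) → ((s - r : ℚ) : ℝ) < δ →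
      ∃ F : Finset (ℚ × ℚ),
        IsRatIntervalFamily F (Subtype.val '' U ∩ Set.Icc (r : ℝ) (s : ℝ)) ∧
          (1 - ε) * ((s - r : ℚ) : ℝ) ≤ ((totalLength F : ℚ) : ℝ)

theorem isRatIntervalFamily_singleton {a b : ℚ} (hab : a ≤ b) {A : Set ℝ}
    (h : Set.Icc (a : ℝ) b ⊆ A) : IsRatIntervalFamily {(a, b)} A := by
  refine ⟨fun p hp => ?_, by simp⟩
  obtain rfl := Finset.mem_singleton.1 hp
  exact ⟨hab, h⟩

theorem IsRatIntervalFamily.mono {F : Finset (ℚ × ℚ)} {A B : Set ℝ}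
    (h : IsRatIntervalFamily F A) (hAB : A ⊆ B) : IsRatIntervalFamily F B :=
  ⟨fun p hp => ⟨(h.1 p hp).1, (h.1 p hp).2.trans hAB⟩, h.2⟩

theorem hasFineDensity_of_mem_nhds {U : Set unitInterval} {x : unitInterval}
    (h : U ∈ nhds x) : HasFineDensity U x := by
  intro ε hε
  obtain ⟨δ, hδ, hU⟩ := Metric.mem_nhds_iff.1 h
  refine ⟨δ, hδ, fun r s hr hs hrx hxs hlt => ⟨{(r, s)}, ?_, ?_⟩⟩
  · refine isRatIntervalFamily_singleton (by exact_mod_cast hrx.trans hxs) fun t ht => ⟨?_, ht⟩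
    have h0 : (0 : ℝ) ≤ t := le_trans (by exact_mod_cast hr) ht.1
    have h1 : t ≤ 1 := ht.2.trans (by exact_mod_cast hs)
    refine ⟨⟨t, h0, h1⟩, hU ?_, rfl⟩
    rw [Metric.mem_ball, Subtype.dist_eq, Real.dist_eq, abs_lt]
    push_cast at hlt
    constructor <;> linarith [ht.1, ht.2]
  · have : (0 : ℝ) ≤ ((s - r : ℚ) : ℝ) := by
      push_cast
      linarith
    simp only [totalLength, Finset.sum_singleton]
    nlinarith

/-- The trace on `[0,1]` of a closed interval with rational endpoints. -/
def ratIcc (a b : ℚ) : Set unitInterval :=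
  {z | (a : ℝ) ≤ z ∧ (z : ℝ) ≤ b}

theorem isClosed_ratIcc (a b : ℚ) : IsClosed (ratIcc a b) :=
  (isClosed_le continuous_const continuous_subtype_val).inter
    (isClosed_le continuous_subtype_val continuous_const)

/-- The endpoints are rational and so carry no condition; irrational points of the interval are
interior. -/
theorem isFineOpen_ratIcc (a b : ℚ) : IsFineOpen (ratIcc a b) := by
  intro x hx hirr
  refine hasFineDensity_of_mem_nhds ?_
  have h1 : (a : ℝ) < x := lt_of_le_of_ne hx.1 (hirr.ne_rat a).symm
  have h2 : (x : ℝ) < b := lt_of_le_of_ne hx.2 (hirr.ne_rat b)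
  filter_upwards [(isOpen_lt continuous_const continuous_subtype_val).mem_nhds h1,
    (isOpen_lt continuous_subtype_val continuous_const).mem_nhds h2] with z hz1 hz2
  exact ⟨le_of_lt hz1, le_of_lt hz2⟩

theorem isClopen_ratIcc (a b : ℚ) : @IsClopen _ fineTopology (ratIcc a b) := by
  refine ⟨(@isOpen_compl_iff _ _ fineTopology).1 fun x hx _ => ?_, isFineOpen_ratIcc a b⟩
  exact hasFineDensity_of_mem_nhds ((isClosed_ratIcc a b).isOpen_compl.mem_nhds hx)

/-- Keep the parts of [r, s] left of `a - η` and right of `b + η`, dropping empty ones. The gaps `η`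
keep these closed intervals off [a, b]. -/
theorem exists_isRatIntervalFamily_compl_Icc {a b r s η : ℚ} (hab : a ≤ b) (hrs : r ≤ s)
    (hη : 0 < η) :
    ∃ F, IsRatIntervalFamily F ((Set.Icc (a : ℝ) b)ᶜ ∩ Set.Icc (r : ℝ) s) ∧
      (s - r) - (b - a) - 2 * η ≤ totalLength F := by
  have hL : Set.Icc (r : ℝ) (min s (a - η) : ℚ) ⊆ (Set.Icc (a : ℝ) b)ᶜ ∩ Set.Icc (r : ℝ) s := by
    intro t ht
    have h1 : ((min s (a - η) : ℚ) : ℝ) ≤ s := by exact_mod_cast min_le_left _ _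
    have h2 : ((min s (a - η) : ℚ) : ℝ) < a := by
      exact_mod_cast (min_le_right _ _).trans_lt (by linarith)
    exact ⟨fun h => absurd h.1 (by linarith [ht.2]), ht.1, ht.2.trans h1⟩
  have hR : Set.Icc ((max r (b + η) : ℚ) : ℝ) s ⊆ (Set.Icc (a : ℝ) b)ᶜ ∩ Set.Icc (r : ℝ) s := by
    intro t ht
    have h1 : (r : ℝ) ≤ (max r (b + η) : ℚ) := by exact_mod_cast le_max_left _ _
    have h2 : (b : ℝ) < (max r (b + η) : ℚ) := by
      exact_mod_cast lt_of_lt_of_le (by linarith) (le_max_right _ _)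
    exact ⟨fun h => absurd h.2 (by linarith [ht.1]), h1.trans ht.1, ht.2⟩
  by_cases h1 : r ≤ min s (a - η) <;> by_cases h2 : max r (b + η) ≤ s
  · have hlt : min s (a - η) < max r (b + η) :=
      (min_le_right _ _).trans_lt (lt_of_lt_of_le (by linarith) (le_max_right _ _))
    have hne : (r, min s (a - η)) ≠ (max r (b + η), s) := by
      intro h
      have := congrArg Prod.fst h
      simp only at this
      linarith
    refine ⟨{(r, min s (a - η)), (max r (b + η), s)}, ⟨?_, ?_⟩, ?_⟩
    · intro p hp
      rcases Finset.mem_insert.1 hp with rfl | hp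
      · exact ⟨h1, hL⟩
      · obtain rfl := Finset.mem_singleton.1 hp
        exact ⟨h2, hR⟩
    · rw [Finset.coe_pair, Set.pairwiseDisjoint_insert]
      refine ⟨by simp, fun q hq _ => ?_⟩
      obtain rfl := Set.mem_singleton_iff.1 hq
      refine Set.disjoint_left.2 fun t ht ht' => ?_
      have : ((min s (a - η) : ℚ) : ℝ) < (max r (b + η) : ℚ) := by exact_mod_cast hlt
      exact absurd (ht'.1.trans ht.2) (not_le.2 this)
    · rw [totalLength, Finset.sum_pair hne]
      simp only
      rcases min_choice s (a - η) with h | h <;> rcases max_choice r (b + η) with h' | h' <;>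
        rw [h, h'] at hlt ⊢ <;> linarith [le_of_lt hη]
  · refine ⟨{(r, min s (a - η))}, isRatIntervalFamily_singleton h1 hL, ?_⟩
    rw [totalLength, Finset.sum_singleton]
    have h3 : s < b + η := (lt_max_iff.1 (not_le.1 h2)).resolve_left (not_lt.2 hrs)
    simp only
    rcases min_choice s (a - η) with h | h <;> rw [h] <;> linarith
  · refine ⟨{(max r (b + η), s)}, isRatIntervalFamily_singleton h2 hR, ?_⟩
    rw [totalLength, Finset.sum_singleton]
    have h3 : a - η < r := (min_lt_iff.1 (not_le.1 h1)).resolve_left (not_lt.2 hrs)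
    simp only
    rcases max_choice r (b + η) with h | h <;> rw [h] <;> linarith
  · refine ⟨∅, ⟨by simp, by simp⟩, ?_⟩
    have h3 : s < b + η := (lt_max_iff.1 (not_le.1 h2)).resolve_left (not_lt.2 hrs)
    have h4 : a - η < r := (min_lt_iff.1 (not_le.1 h1)).resolve_left (not_lt.2 hrs)
    rw [totalLength, Finset.sum_empty]
    linarith

/-- If the intervals `[a n, b n]` converge to `x` quickly and are short compared to their distance
from `x`, then the complement of their union satisfies the density condition at `x`. -/
theorem hasFineDensity_of_sparse {x : unitInterval} (hx : Irrational (x : ℝ)) {a b : ℕ → ℚ}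
    {ρ : ℕ → ℝ} (hρ : ∀ n, 0 < ρ n) (hanti : Antitone ρ)
    (hlim : Filter.Tendsto ρ Filter.atTop (nhds 0)) (hab : ∀ n, a n ≤ b n)
    (hnear : ∀ n, ∀ z ∈ Set.Icc (a n : ℝ) (b n), ρ n ≤ |z - x| ∧ |z - x| ≤ 3 * ρ n)
    (hlen : ∀ n, ((b n : ℝ) - a n) ≤ ρ n / 2 ^ n) :
    HasFineDensity {z | ∀ n, z ∉ ratIcc (a n) (b n)} x := by
  intro ε hε
  -- The relative loss will be at most 4 / 2 ^ m for finitely many single intervals plus 2 / 2 ^ m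
  -- for the tail.
  obtain ⟨m, hm⟩ : ∃ m : ℕ, 6 / 2 ^ m ≤ ε := by
    obtain ⟨m, hm⟩ := exists_pow_lt_of_lt_one (show 0 < ε / 6 by positivity)
      (show (1 / 2 : ℝ) < 1 by norm_num)
    refine ⟨m, ?_⟩
    rw [one_div, inv_pow] at hm
    rw [div_eq_mul_inv]
    linarith
  -- With this `δ`, [r, s] is too short to reach any interval of index below `m`.
  refine ⟨ρ m, hρ m, fun r s hr hs hrx hxs hlt => ?_⟩
  push_cast at hlt
  have hrs' : (r : ℝ) < s :=
    (lt_of_le_of_ne hrx (hx.ne_rat r).symm).trans_le hxs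
  have hrs : r < s := by exact_mod_cast hrs'
  have hL : 0 < s - r := sub_pos.2 hrs
  -- removing one interval
  have hone : ∀ n, ∃ F, IsRatIntervalFamily F
      ((Set.Icc (a n : ℝ) (b n))ᶜ ∩ Set.Icc (r : ℝ) s) ∧
      (s - r) - 2 * ((s - r) / 2 ^ n) ≤ totalLength F := by
    intro n
    by_cases hmeet : ∃ z ∈ Set.Icc (a n : ℝ) (b n), z ∈ Set.Icc (r : ℝ) s
    · obtain ⟨z, hz, hz'⟩ := hmeet
      obtain ⟨F, hF, hFl⟩ := exists_isRatIntervalFamily_compl_Icc (hab n) hrs.le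
        (show 0 < (s - r) / 2 ^ n / 2 by positivity)
      refine ⟨F, hF, le_trans ?_ hFl⟩
      -- Both `z` and `x` lie in [r, s], so an interval that meets [r, s] is short relative to it.
      have h1 : ρ n ≤ s - r :=
        (hnear n z hz).1.trans (abs_le.2 ⟨by linarith [hz'.1, hxs], by linarith [hz'.2, hrx]⟩)
      have h2 : (b n : ℝ) - a n ≤ (s - r) / 2 ^ n :=
        (hlen n).trans (div_le_div_of_nonneg_right h1 (by positivity))
      have h3 : b n - a n ≤ (s - r) / 2 ^ n := by exact_mod_cast h2
      linarith
    · refine ⟨{(r, s)}, isRatIntervalFamily_singleton hrs.le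
        fun t ht => ⟨fun h => hmeet ⟨t, h, ht⟩, ht⟩, ?_⟩
      have : 0 ≤ (s - r) / 2 ^ n := by positivity
      simp only [totalLength, Finset.sum_singleton]
      linarith
  -- The losses 2 / 2 ^ n for m ≤ n < m + k add up to 4 / 2 ^ m - 4 / 2 ^ (m + k).
  have hmany : ∀ k : ℕ, ∃ F, IsRatIntervalFamily F
      ({t | ∀ n, m ≤ n → n < m + k → t ∉ Set.Icc (a n : ℝ) (b n)} ∩ Set.Icc (r : ℝ) s) ∧
      (s - r) - 4 * ((s - r) / 2 ^ m) + 4 * ((s - r) / 2 ^ (m + k)) ≤ totalLength F := by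
    intro k
    induction k with
    | zero =>
      refine ⟨{(r, s)}, isRatIntervalFamily_singleton hrs.le
        fun t ht => ⟨fun n h1 h2 => by omega, ht⟩, ?_⟩
      simp [totalLength]
    | succ k ih =>
      obtain ⟨F, hF, hFl⟩ := ih
      obtain ⟨F', hF', hFl'⟩ := hone (m + k)
      obtain ⟨N, hN, hNl⟩ := hF.inter hrs'.le hF'
      refine ⟨N, hN.mono ?_, ?_⟩
      · rintro t ⟨⟨h1, h2⟩, h3⟩
        refine ⟨fun n hn hn' => ?_, h3⟩
        rcases Nat.lt_succ_iff_lt_or_eq.1 hn' with h | rfl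
        · exact h1 n hn h
        · exact h2
      · have h4 : totalLength F + totalLength F' - (s - r) ≤ totalLength N := by
          exact_mod_cast hNl
        have h5 : (s - r) / 2 ^ (m + (k + 1)) = (s - r) / 2 ^ (m + k) / 2 := by
          rw [← add_assoc, pow_succ, div_div]
        rw [h5]
        linarith
  -- the tail is contained in one short interval
  have hc : 0 < ((s - r) / 2 ^ m / 2 : ℝ) := by
    have : (0 : ℝ) < s - r := sub_pos.2 hrs'
    positivity
  obtain ⟨u, hu, hux⟩ := exists_rat_btwn (show (x : ℝ) - (s - r) / 2 ^ m / 2 < x by linarith)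
  obtain ⟨v, hxv, hv⟩ := exists_rat_btwn (show (x : ℝ) < x + (s - r) / 2 ^ m / 2 by linarith)
  have huv : u ≤ v := by exact_mod_cast (hux.trans hxv).le
  have huvl : v - u ≤ (s - r) / 2 ^ m := by
    have : (v : ℝ) - u ≤ (s - r) / 2 ^ m := by linarith
    exact_mod_cast this
  obtain ⟨M, hM⟩ := Filter.eventually_atTop.1 (hlim.eventually (gt_mem_nhds
    (show 0 < min ((x : ℝ) - u) (v - x) / 3 from
      div_pos (lt_min (by linarith) (by linarith)) (by norm_num))))
  obtain ⟨F, hF, hFl⟩ := hmany M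
  obtain ⟨F', hF', hFl'⟩ := exists_isRatIntervalFamily_compl_Icc huv hrs.le
    (show 0 < (s - r) / 2 ^ m / 2 by positivity)
  obtain ⟨N, hN, hNl⟩ := hF.inter hrs'.le hF'
  refine ⟨N, hN.mono ?_, ?_⟩
  · rintro t ⟨⟨h1, h2⟩, h3⟩
    have h4 : (0 : ℝ) ≤ t := le_trans (by exact_mod_cast hr) h3.1
    have h5 : t ≤ 1 := h3.2.trans (by exact_mod_cast hs)
    refine ⟨⟨⟨t, h4, h5⟩, fun n hn => ?_, rfl⟩, h3⟩
    have hn' : t ∈ Set.Icc (a n : ℝ) (b n) := hn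
    rcases lt_or_ge n m with h | h
    · have h6 := (hnear n t hn').1
      have h7 := hanti h.le
      have h8 : |t - x| ≤ s - r := abs_le.2 ⟨by linarith [h3.1], by linarith [h3.2]⟩
      linarith
    · rcases lt_or_ge n (m + M) with h' | h'
      · exact h1 n h h' hn'
      · have h6 := hM n (by omega)
        have h7 := (abs_le.1 (hnear n t hn').2)
        have h8 := min_le_left ((x : ℝ) - u) (v - x)
        have h9 := min_le_right ((x : ℝ) - u) (v - x)
        exact h2 ⟨by linarith [h7.1], by linarith [h7.2]⟩
  · have h4 : totalLength F + totalLength F' - (s - r) ≤ totalLength N := by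
      exact_mod_cast hNl
    have h5 : 0 ≤ (s - r) / 2 ^ (m + M) := by positivity
    have h6 : (s - r) - 6 * ((s - r) / 2 ^ m) ≤ totalLength N := by linarith
    have h7 : ((s - r : ℚ) : ℝ) - 6 * ((s - r : ℚ) / 2 ^ m) ≤ totalLength N := by
      exact_mod_cast h6
    refine le_trans ?_ h7
    have h8 : (0 : ℝ) ≤ (s - r : ℚ) := by exact_mod_cast hL.le
    have h9 := mul_le_mul_of_nonneg_right hm h8
    have h10 : (6 : ℝ) / 2 ^ m * (s - r : ℚ) = 6 * ((s - r : ℚ) / 2 ^ m) := by ring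
    linarith

/-! ### The finite support of a homomorphism on `fineG` -/

theorem mem_fineG_iff (f : unitInterval → ℤ) :
    f ∈ fineG ↔ @IsLocallyConstant _ _ fineTopology f :=
  (@IsLocallyConstant.iff_continuous _ _ fineTopology _ _ f).symm

theorem exists_rat_around (y : ℝ) {c : ℝ} (hc : 0 < c) :
    ∃ a b : ℚ, (a : ℝ) < y ∧ y < b ∧ (b : ℝ) - a ≤ c := by
  obtain ⟨a, ha, hay⟩ := exists_rat_btwn (show y - c / 2 < y by linarith)
  obtain ⟨b, hyb, hb⟩ := exists_rat_btwn (show y < y + c / 2 by linarith)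
  exact ⟨a, b, hay, hyb, by linarith⟩

theorem exists_ratIcc_subset {U : Set unitInterval} {x : unitInterval} (h : U ∈ nhds x) :
    ∃ a b : ℚ, x ∈ ratIcc a b ∧ ratIcc a b ⊆ U := by
  obtain ⟨δ, hδ, hU⟩ := Metric.mem_nhds_iff.1 h
  obtain ⟨a, b, ha, hb, hab⟩ := exists_rat_around (x : ℝ) (half_pos hδ)
  refine ⟨a, b, ⟨ha.le, hb.le⟩, fun z hz => hU ?_⟩
  rw [Metric.mem_ball, Subtype.dist_eq, Real.dist_eq, abs_lt]
  constructor <;> linarith [hz.1, hz.2]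

/-- The points that belong to no null closed interval with rational endpoints. -/
def fineSupport (φ : fineG →+ ℤ) : Set unitInterval :=
  {x | ∀ a b : ℚ, IsNullFor φ (ratIcc a b) → x ∉ ratIcc a b}

theorem exists_seq_mem_of_accPt {T : Set unitInterval} {x : unitInterval}
    (h : AccPt x (Filter.principal T)) :
    ∃ y : ℕ → unitInterval, (∀ n, y n ∈ T) ∧ (∀ n, y n ≠ x) ∧
      ∀ n, dist (y (n + 1)) x ≤ dist (y n) x / 8 := by
  have hstep : ∀ c : ℝ, 0 < c → ∃ y ∈ T, y ≠ x ∧ dist y x ≤ c := by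
    intro c hc
    obtain ⟨y, ⟨hy1, hy2⟩, hy3⟩ := accPt_iff_nhds.1 h _ (Metric.ball_mem_nhds x hc)
    exact ⟨y, hy2, hy3, (Metric.mem_ball.1 hy1).le⟩
  obtain ⟨y₀, h₀, h₀', -⟩ := hstep 1 one_pos
  choose f hfT hfx hfd using fun p : {y // y ∈ T ∧ y ≠ x} =>
    hstep (dist p.1 x / 8) (div_pos (dist_pos.2 p.2.2) (by norm_num))
  let p : ℕ → {y // y ∈ T ∧ y ≠ x} := fun n =>
    Nat.rec ⟨y₀, h₀, h₀'⟩ (fun _ q => ⟨f q, hfT q, hfx q⟩) n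
  exact ⟨fun n => (p n).1, fun n => (p n).2.1, fun n => (p n).2.2, fun n => hfd (p n)⟩

/-- Away from `x` the intervals are locally finite, so the complement of their union is an ordinary
neighbourhood of each of its other points; only `x` needs the density hypothesis. -/
theorem isLocallyConstant_of_sparse {x : unitInterval} {a b : ℕ → ℚ} {ρ : ℕ → ℝ}
    (hlim : Filter.Tendsto ρ Filter.atTop (nhds 0))
    (hnear : ∀ n, ∀ z ∈ ratIcc (a n) (b n), dist z x ≤ 3 * ρ n)
    (hx : Irrational (x : ℝ) → HasFineDensity {z | ∀ n, z ∉ ratIcc (a n) (b n)} x)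
    {ν : unitInterval → ℕ} (hν0 : ∀ z, ν z = 0 ↔ ∀ n, z ∉ ratIcc (a n) (b n))
    (hν1 : ∀ z n, ν z = n + 1 ↔ z ∈ ratIcc (a n) (b n)) :
    @IsLocallyConstant _ _ fineTopology ν := by
  refine (@IsLocallyConstant.iff_continuous _ _ fineTopology _ _ ν).2
    ((@continuous_discrete_rng _ _ fineTopology _ _ _).2 fun n => ?_)
  rcases n with _ | n
  · have h0 : ν ⁻¹' {0} = {z | ∀ n, z ∉ ratIcc (a n) (b n)} := by
      ext z
      exact hν0 z
    rw [h0]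
    intro y hy hirr
    by_cases hyx : y = x
    · subst hyx
      exact hx hirr
    refine hasFineDensity_of_mem_nhds ?_
    have hpos := dist_pos.2 hyx
    obtain ⟨N, hN⟩ := Filter.eventually_atTop.1 (hlim.eventually (gt_mem_nhds
      (show 0 < dist y x / 6 by positivity)))
    have hfar : {z | dist y x / 2 < dist z x} ∈ nhds y :=
      (isOpen_lt continuous_const (continuous_id.dist continuous_const)).mem_nhds
        (show dist y x / 2 < dist y x by linarith)
    have hfin : (⋂ n ∈ Set.Iio N, (ratIcc (a n) (b n))ᶜ) ∈ nhds y :=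
      (Filter.biInter_mem (Set.finite_Iio N)).2 fun n _ =>
        (isClosed_ratIcc _ _).isOpen_compl.mem_nhds (hy n)
    filter_upwards [hfar, hfin] with z hz1 hz2 n hn
    rcases lt_or_ge n N with h | h
    · exact Set.mem_iInter₂.1 hz2 n h hn
    · have h1 := hN n h
      have h2 := hnear n z hn
      have h3 : dist y x / 2 < dist z x := hz1
      linarith
  · have h1 : ν ⁻¹' {n + 1} = ratIcc (a n) (b n) := by
      ext z
      exact hν1 z n
    rw [h1]
    exact isFineOpen_ratIcc _ _

theorem fineSupport_finite (φ : fineG →+ ℤ) : (fineSupport φ).Finite := by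
  classical
  by_contra hinf
  obtain ⟨x, hacc⟩ := Set.Infinite.exists_accPt_principal hinf
  obtain ⟨y, hyT, hyx, hyd⟩ := exists_seq_mem_of_accPt hacc
  -- Points within `ρ n` of `y n` have distance between `ρ n` and `3 * ρ n` from `x`; the ratio 1/8
  -- makes these shells disjoint.
  let ρ : ℕ → ℝ := fun n => dist (y n) x / 2
  have hρ : ∀ n, 0 < ρ n := fun n => half_pos (dist_pos.2 (hyx n))
  have hρ8 : ∀ n, ρ (n + 1) ≤ ρ n / 8 := fun n => by
    have := hyd n
    simp only [ρ]
    linarith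
  have hanti : Antitone ρ := antitone_nat_of_succ_le fun n => by
    have := hρ n
    have := hρ8 n
    linarith
  have hlim : Filter.Tendsto ρ Filter.atTop (nhds 0) := by
    have hle : ∀ n, ρ n ≤ ρ 0 * (1 / 8) ^ n := by
      intro n
      induction n with
      | zero => simp
      | succ k ih =>
        have := hρ8 k
        rw [pow_succ]
        linarith
    refine squeeze_zero (fun n => (hρ n).le) hle ?_
    simpa using (tendsto_pow_atTop_nhds_zero_of_lt_one (show (0 : ℝ) ≤ 1 / 8 by norm_num)
      (by norm_num)).const_mul (ρ 0)
  choose a b hay hyb hlen using fun n => exists_rat_around (y n : ℝ)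
    (show 0 < ρ n / 2 ^ n from div_pos (hρ n) (by positivity))
  have hnear : ∀ n, ∀ z ∈ Set.Icc (a n : ℝ) (b n), ρ n ≤ |z - x| ∧ |z - x| ≤ 3 * ρ n := by
    intro n z hz
    have h1 : |(y n : ℝ) - x| = 2 * ρ n := by
      simp only [ρ, Subtype.dist_eq, Real.dist_eq]
      ring
    have h2 : ρ n / 2 ^ n ≤ ρ n := div_le_self (hρ n).le (one_le_pow₀ (by norm_num))
    have h3 : |z - y n| ≤ ρ n :=
      abs_le.2 ⟨by linarith [hz.1, hyb n, hlen n], by linarith [hz.2, hay n, hlen n]⟩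
    have h4 := abs_sub_le z (y n) (x : ℝ)
    have h5 := abs_sub_le (y n : ℝ) z x
    rw [abs_sub_comm (y n : ℝ) z] at h5
    constructor <;> linarith
  have hnear' : ∀ n, ∀ z ∈ ratIcc (a n) (b n), ρ n ≤ dist z x ∧ dist z x ≤ 3 * ρ n :=
    fun n z hz => hnear n z hz
  have hdisj : ∀ m n z, z ∈ ratIcc (a m) (b m) → z ∈ ratIcc (a n) (b n) → m = n := by
    have hlt : ∀ m n z, m < n → z ∈ ratIcc (a m) (b m) → z ∉ ratIcc (a n) (b n) := by
      intro m n z hmn hm hn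
      have h1 := (hnear' m z hm).1
      have h2 := (hnear' n z hn).2
      have h3 := hanti (Nat.succ_le_of_lt hmn)
      have h4 := hρ8 m
      have h5 := hρ m
      simp only [Nat.succ_eq_add_one] at h3
      linarith
    intro m n z hm hn
    rcases lt_trichotomy m n with h | h | h
    · exact absurd hn (hlt m n z h hm)
    · exact h
    · exact absurd hm (hlt n m z h hn)
  let ν : unitInterval → ℕ := fun z =>
    if h : ∃ n, z ∈ ratIcc (a n) (b n) then h.choose + 1 else 0
  have hν0 : ∀ z, ν z = 0 ↔ ∀ n, z ∉ ratIcc (a n) (b n) := by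
    intro z
    by_cases h : ∃ n, z ∈ ratIcc (a n) (b n)
    · simp only [ν, dif_pos h, Nat.succ_ne_zero, false_iff, not_forall, not_not]
      exact h
    · simp only [ν, dif_neg h, true_iff]
      exact not_exists.1 h
  have hν1 : ∀ z n, ν z = n + 1 ↔ z ∈ ratIcc (a n) (b n) := by
    intro z n
    by_cases h : ∃ n, z ∈ ratIcc (a n) (b n)
    · simp only [ν, dif_pos h, Nat.succ_inj]
      exact ⟨fun h' => h' ▸ h.choose_spec, fun h' => hdisj _ _ z h.choose_spec h'⟩
    · have h' := not_exists.1 h n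
      simp [ν, h, h']
  have hν := isLocallyConstant_of_sparse hlim (fun n z hz => (hnear' n z hz).2)
    (fun hx => hasFineDensity_of_sparse hx hρ hanti hlim
      (fun n => by exact_mod_cast ((hay n).trans (hyb n)).le) hnear hlen) hν0 hν1
  obtain ⟨N, hN⟩ := @exists_forall_isNullFor_fiber _ fineG fineTopology mem_fineG_iff φ ν hν
  -- The label 0 is the complement of the union, so interval `N` has label `N + 1`.
  have hnull : IsNullFor φ (ratIcc (a N) (b N)) :=
    (hN (N + 1) N.le_succ).mono fun z hz => (hν1 z N).2 hz
  exact hyT N _ _ hnull ⟨(hay N).le, (hyb N).le⟩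

/-- A homomorphism on `fineG` annihilates the functions that vanish on its support. -/
theorem map_eq_zero_of_eqOn_fineSupport (φ : fineG →+ ℤ) (g : fineG)
    (hg : ∀ x ∈ fineSupport φ, g.1 x = 0) : φ g = 0 := by
  have hne : {p : ℚ × ℚ | IsNullFor φ (ratIcc p.1 p.2)}.Nonempty := by
    -- The empty interval is null, so the null intervals can be enumerated by ℕ.
    refine ⟨(1, 0), fun f hf => ?_⟩
    have : f = 0 := by
      ext z
      refine hf z fun hz => ?_
      have := hz.1.trans hz.2
      norm_num at this
    rw [this, map_zero]
  obtain ⟨p, hp⟩ := (Set.to_countable {p : ℚ × ℚ | IsNullFor φ (ratIcc p.1 p.2)}).exists_eq_range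
    hne
  have hnull : ∀ n, IsNullFor φ (ratIcc (p n).1 (p n).2) := fun n => by
    have : p n ∈ {p : ℚ × ℚ | IsNullFor φ (ratIcc p.1 p.2)} := hp ▸ Set.mem_range_self n
    exact this
  have hC : @IsClopen _ fineTopology {x | g.1 x ≠ 0} :=
    @IsClopen.compl _ fineTopology _
      (@IsLocallyConstant.isClopen_fiber _ _ fineTopology _ ((mem_fineG_iff _).1 g.2) 0)
  refine @IsNullFor.of_subset_iUnion _ fineG fineTopology mem_fineG_iff φ {x | g.1 x ≠ 0} hC
    (fun n => ratIcc (p n).1 (p n).2) (fun n => isClopen_ratIcc _ _) hnull ?_ g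
    fun y hy => not_not.1 hy
  intro x hx
  have hxT : x ∉ fineSupport φ := fun h => hx (hg x h)
  obtain ⟨a, b, hab, hxab⟩ : ∃ a b : ℚ, IsNullFor φ (ratIcc a b) ∧ x ∈ ratIcc a b := by
    simpa [fineSupport] using hxT
  have hmem : (a, b) ∈ {p : ℚ × ℚ | IsNullFor φ (ratIcc p.1 p.2)} := hab
  rw [hp] at hmem
  obtain ⟨n, hn⟩ := hmem
  refine Set.mem_iUnion.2 ⟨n, ?_⟩
  rw [hn]
  exact hxab

/-! ### The basis of evaluations -/

theorem exists_fineG_separating (x : unitInterval) (T : Finset unitInterval) :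
    ∃ g : fineG, g.1 x = 1 ∧ ∀ t ∈ T, t ≠ x → g.1 t = 0 := by
  classical
  have hU : ((T.erase x : Finset unitInterval) : Set unitInterval)ᶜ ∈ nhds x :=
    (T.erase x).finite_toSet.isClosed.isOpen_compl.mem_nhds (by simp)
  obtain ⟨a, b, hx, hab⟩ := exists_ratIcc_subset hU
  refine ⟨⟨(ratIcc a b).indicator 1, (mem_fineG_iff _).2 ?_⟩, ?_, fun t ht htx => ?_⟩
  · exact (@IsLocallyConstant.iff_continuous _ _ fineTopology _ _ _).2
      (@IsClopen.continuous_indicator _ _ fineTopology _ _ _ _ (isClopen_ratIcc a b)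
        (@continuous_const _ _ fineTopology _ _))
  · simp [hx]
  · have : t ∉ ratIcc a b := fun h => hab h (by simp [ht, htx])
    simp [this]

theorem evalHom_apply (x : unitInterval) (g : fineG) : evalHom x g = g.1 x := rfl

theorem linearIndependent_evalHom : LinearIndependent ℤ evalHom := by
  rw [linearIndependent_iff']
  intro T c hc x hx
  obtain ⟨g, hg1, hg0⟩ := exists_fineG_separating x T
  have h := DFunLike.congr_fun hc g
  rw [AddMonoidHom.finsetSum_apply, Finset.sum_eq_single x] at h
  · simpa [evalHom_apply, hg1] using h
  · intro t ht htx
    simp [evalHom_apply, hg0 t ht htx]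
  · exact fun h => absurd hx h

theorem span_evalHom : ⊤ ≤ Submodule.span ℤ (Set.range evalHom) := by
  intro φ _
  let T := (fineSupport_finite φ).toFinset
  choose e he1 he0 using fun x => exists_fineG_separating x T
  -- Subtracting the interpolation `∑ g(t) e t` leaves a function that vanishes on the support.
  have hφ : φ = ∑ t ∈ T, φ (e t) • evalHom t := by
    ext g
    have h0 : φ (g - ∑ t ∈ T, g.1 t • e t) = 0 := by
      refine map_eq_zero_of_eqOn_fineSupport φ _ fun x hx => ?_
      have hxT : x ∈ T := (fineSupport_finite φ).mem_toFinset.2 hx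
      rw [← evalHom_apply, map_sub, map_sum, Finset.sum_eq_single x]
      · simp [evalHom_apply, he1]
      · intro t ht htx
        simp [evalHom_apply, he0 t x hxT htx.symm]
      · exact fun h => absurd hxT h
    rw [map_sub, sub_eq_zero, map_sum] at h0
    rw [h0, AddMonoidHom.finsetSum_apply]
    refine Finset.sum_congr rfl fun t _ => ?_
    rw [map_zsmul, smul_eq_mul, mul_comm]
    simp [evalHom_apply]
  rw [hφ]
  exact Submodule.sum_mem _ fun t _ => Submodule.smul_mem _ _ (Submodule.subset_span ⟨t, rfl⟩)

/-! ### Restriction to the rationals and the embedding in ℤ^ℕ -/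

/-- The level set through an irrational point is fine-open, hence contains an interval with rational
endpoints: every value is taken at a rational point. -/
theorem restrictHom_injective : Function.Injective restrictHom := by
  refine (injective_iff_map_eq_zero _).2 fun g hg => ?_
  have hrat : ∀ y : RatPoint, g.1 y.1 = 0 := fun y => congrFun (congrArg Subtype.val hg) y
  ext x
  by_cases hx : Irrational (x : ℝ)
  · have hopen : IsFineOpen (g.1 ⁻¹' {g.1 x}) := (mem_fineG_iff _).1 g.2 _
    obtain ⟨δ, hδ, h⟩ := hopen x rfl hx (1 / 2) (by norm_num)
    have hx0 : (0 : ℝ) < x := lt_of_le_of_ne x.2.1 (by simpa using (hx.ne_rat 0).symm)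
    have hx1 : (x : ℝ) < 1 := lt_of_le_of_ne x.2.2 (by simpa using hx.ne_rat 1)
    -- The bounds keep [a, b] inside [0,1] and shorter than `δ`.
    obtain ⟨a, b, ha, hb, hab⟩ := exists_rat_around (x : ℝ)
      (show 0 < min (δ / 2) (min (x : ℝ) (1 - x)) from
        lt_min (half_pos hδ) (lt_min hx0 (sub_pos.2 hx1)))
    have h1 := hab.trans (min_le_left _ _)
    have h2 := (hab.trans (min_le_right _ _)).trans (min_le_left _ _)
    have h3 := (hab.trans (min_le_right _ _)).trans (min_le_right _ _)
    obtain ⟨F, hF, hFl⟩ := h a b (by exact_mod_cast (show (0 : ℝ) ≤ a by linarith))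
      (by exact_mod_cast (show (b : ℝ) ≤ 1 by linarith)) ha.le hb.le
      (by push_cast; linarith)
    have hne : F.Nonempty := by
      by_contra hF0
      rw [Finset.not_nonempty_iff_eq_empty] at hF0
      rw [hF0] at hFl
      simp only [totalLength, Finset.sum_empty] at hFl
      push_cast at hFl
      linarith
    obtain ⟨p, hp⟩ := hne
    obtain ⟨hp1, hp2⟩ := hF.1 p hp
    obtain ⟨⟨z, hz, hzp⟩, -⟩ := hp2 ⟨le_refl (p.1 : ℝ), by exact_mod_cast hp1⟩
    have hz' : g.1 z = g.1 x := hz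
    rw [← hz']
    exact hrat ⟨z, p.1, hzp.symm⟩
  · rw [Irrational, not_not] at hx
    obtain ⟨q, hq⟩ := hx
    exact hrat ⟨x, q, hq⟩

theorem restrictHom_bijective : Function.Bijective restrictHom :=
  ⟨restrictHom_injective, restrictRat.addSubgroupMap_surjective fineG⟩

instance : Countable RatPoint :=
  Function.Injective.countable (f := fun x : RatPoint => x.2.choose) fun x y h => by
    refine Subtype.ext (Subtype.ext ?_)
    rw [← x.2.choose_spec, ← y.2.choose_spec]
    exact congrArg _ h

instance : Infinite RatPoint :=
  Infinite.of_injective (fun n : ℕ => (⟨⟨((n + 1 : ℝ))⁻¹, by positivity,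
    inv_le_one_of_one_le₀ (by linarith [n.cast_nonneg (α := ℝ)])⟩,
      ⟨((n + 1 : ℚ))⁻¹, by push_cast; rfl⟩⟩ : RatPoint)) fun m n h => by
    have h' := congrArg (fun x : RatPoint => (x.1 : ℝ)) h
    simpa using h'

theorem corollary4p8 :
    (∃ b : Module.Basis unitInterval ℤ (fineG →+ ℤ), ∀ x, b x = evalHom x) ∧
    Function.Bijective restrictHom ∧
    Function.Bijective (fun φ : fineG₀ →+ ℤ => φ.comp restrictHom) ∧
    (∃ H : AddSubgroup (ℕ → ℤ), Nonempty (fineG₀ ≃+ H) ∧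
      Module.Free ℤ (H →+ ℤ) ∧ Module.rank ℤ (H →+ ℤ) = Cardinal.continuum) := by
  let e : fineG ≃+ fineG₀ := AddEquiv.ofBijective restrictHom restrictHom_bijective
  let B : Module.Basis unitInterval ℤ (fineG →+ ℤ) :=
    Module.Basis.mk linearIndependent_evalHom span_evalHom
  refine ⟨⟨B, fun x => Module.Basis.mk_apply _ _ x⟩, restrictHom_bijective,
    e.symm.addMonoidHomCongrLeft.bijective, ?_⟩
  -- An enumeration of the rational points carries `fineG₀` into ℤ^ℕ, and the basis of evaluations
  -- is transported along.
  obtain ⟨k⟩ := nonempty_equiv_of_countable (α := RatPoint) (β := ℕ)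
  let E : (RatPoint → ℤ) ≃+ (ℕ → ℤ) := AddEquiv.arrowCongr k (AddEquiv.refl ℤ)
  let f : fineG₀ ≃+ fineG₀.map E.toAddMonoidHom :=
    fineG₀.equivMapOfInjective E.toAddMonoidHom E.injective
  let B' : Module.Basis unitInterval ℤ (fineG₀.map E.toAddMonoidHom →+ ℤ) :=
    B.map (e.trans f).addMonoidHomCongrLeft.toIntLinearEquiv
  refine ⟨_, ⟨f⟩, Module.Free.of_basis B', ?_⟩
  rw [← B'.mk_eq_rank'']
  exact Cardinal.mk_Icc_real zero_lt_one
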